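/- Let $r>0$, $\beta>0$, $n\ge 1$, $\mathcal X=[-r,r]$. Let $\mathcal P_r$ be the class of all probability distributions on $\mathbb R$ supported on $[-r,r]$, with mean $\theta(P)=\int x\,dP(x)$, and let $\Theta\subseteq\mathbb R$ be any set containing $[-r,r]$ (for instance $\Theta=[-r,r]$ or $\Theta=\mathbb R$). An estimator is a measurable map $\widehat\theta:\mathcal X^n\times[0,1]\to\Theta$, $(\mathcal D_n,\xi)\mapsto\widehat\theta(\mathcal D_n;\xi)$, where the seed $\xi$ is uniform on $[0,1]$ and independent of the data. It is $\beta$-average-case-stable if $$\frac1{(n+1)^2}\sup_{\mathcal D_{n+1}\in\mathcal X^{n+1}}\ \sum_{1\le i,j\le n+1}\mathbb E_\xi\bigl|\widehat\theta(\mathcal D_{n+1}^{\setminus i};\xi)-\widehat\theta(\mathcal D_{n+1}^{\setminus j};\xi)\bigr|\le\beta,$$ where $\mathcal D_{n+1}^{\setminus i}$ is $\mathcal D_{n+1}$ with its $i$-th point deleted. Let $$R_{n,1}(r,\beta)=\inf_{\widehat\theta\ \beta\text{-average-case-stable}}\ \sup_{P\in\mathcal P_r}\mathbb E_{\mathcal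 D_n\sim P^{\otimes n},\,\xi}\bigl(\widehat\theta(\mathcal D_n;\xi)-\theta(P)\bigr)^2 .$$ Theorem. There are universal constants $N\in\mathbb N$ and $0<c<C$ such that for all $n\ge N$, all $r>0$, all $\beta>0$ and all such $\Theta$, writing $\delta=\bigl(\frac{r}{n\beta}-1\bigr)_+$, $$c\,\max\Bigl\{\Bigl(\frac{\delta}{1+\delta}\Bigr)^3r^2,\ \frac{r^2}{n}\Bigr\}\ \le\ R_{n,1}(r,\beta)\ \le\ C\,\max\Bigl\{\Bigl(\frac{\delta}{1+\delta}\Bigr)^3r^2,\ \frac{r^2}{n}\Bigr\}.$$ Moreover, with $\bar X$ the sample mean, the estimator $$\widehat\theta=\Bigl(1-\min\{\delta,1\}\cdot\min\Bigl\{\frac{2r\sqrt{\delta}+2r/\sqrt n}{|\bar X|},\,1\Bigr\}\Bigr)\bar X$$ (equal to $0$ when $\bar X=0$) takes values in $\Theta$, is $\beta$-average-case-stable, and is rate optimal: $\sup_{P\in\mathcal P_r}\mathbb E(\widehat\theta-\theta(P))^2\le C\,R_{n,1}(r,\beta)$. -/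

import Mathlib

open MeasureTheory
open scoped ENNReal unitInterval

noncomputable section

namespace StableMean

section General

variable {𝒳 : Type*} [MeasurableSpace 𝒳] {E : Type*} [NormedAddCommGroup E] [MeasurableSpace E]
  {n : ℕ}

/-- A (possibly randomized) estimator of a parameter with values in `Θ`: a measurable map from
data sets of size `n` and random seeds in `[0, 1]` to `Θ`. -/
structure IsEstimator (Θ : Set E) (f : (Fin n → 𝒳) × I → E) : Prop where
  measurable : Measurable f
  mem : ∀ z, f z ∈ Θ

/-- Average-case stability with parameter `β`: for data sets `D` of size `n + 1`,
`(n + 1)⁻² · sup_D ∑_{i, j} 𝔼_ξ ‖f (D without i, ξ) - f (D without j, ξ)‖ ≤ β`,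
where the seed `ξ` is uniform on `[0, 1]`. The expectations are Lebesgue integrals with values in
`[0, ∞]`. -/
def IsAverageCaseStable (f : (Fin n → 𝒳) × I → E) (β : ℝ≥0∞) : Prop :=
  (((n : ℝ≥0∞) + 1) ^ 2)⁻¹ * (⨆ D : Fin (n + 1) → 𝒳, ∑ i : Fin (n + 1), ∑ j : Fin (n + 1),
    ∫⁻ ξ : I, ‖f (i.removeNth D, ξ) - f (j.removeNth D, ξ)‖ₑ) ≤ β

/-- The mean-square risk `𝔼 ‖f (X₁, …, Xₙ; ξ) - θ P‖²`, where `X₁, …, Xₙ` are i.i.d. with law `P`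
and `ξ` is an independent seed, uniform on `[0, 1]`. -/
def risk (θ : ProbabilityMeasure 𝒳 → E) (f : (Fin n → 𝒳) × I → E) (P : ProbabilityMeasure 𝒳) :
    ℝ≥0∞ :=
  ∫⁻ z, ‖f z - θ P‖ₑ ^ 2 ∂((Measure.pi fun _ : Fin n => (P : Measure 𝒳)).prod volume)

/-- The worst risk of an estimator over a class `𝒬` of distributions. -/
def maxRisk (𝒬 : Set (ProbabilityMeasure 𝒳)) (θ : ProbabilityMeasure 𝒳 → E)
    (f : (Fin n → 𝒳) × I → E) : ℝ≥0∞ :=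
  ⨆ P ∈ 𝒬, risk θ f P

/-- The minimax risk over all `Θ`-valued estimators, based on `n` observations, that are
average-case stable with parameter `β`. -/
def stableMinimaxRisk (𝒬 : Set (ProbabilityMeasure 𝒳)) (θ : ProbabilityMeasure 𝒳 → E) (Θ : Set E)
    (n : ℕ) (β : ℝ≥0∞) : ℝ≥0∞ :=
  ⨅ (f : (Fin n → 𝒳) × I → E) (_ : IsEstimator Θ f) (_ : IsAverageCaseStable f β), maxRisk 𝒬 θ f

end General

section Bounded

/-- The sample space `{x ∈ ℝ : |x| ≤ r}`. -/
abbrev Ball (r : ℝ) : Type := ↥(Metric.closedBall (0 : ℝ) r)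

/-- The class of all probability distributions supported on `{x ∈ ℝ : |x| ≤ r}`. -/
def boundedClass (r : ℝ) : Set (ProbabilityMeasure (Ball r)) := Set.univ

/-- The mean of a distribution supported on `{x ∈ ℝ : |x| ≤ r}`. -/
def mean {r : ℝ} (P : ProbabilityMeasure (Ball r)) : ℝ :=
  ∫ x : Ball r, (x : ℝ) ∂(P : Measure (Ball r))

/-- The sample mean. -/
def sampleMean {r : ℝ} {n : ℕ} (D : Fin n → Ball r) : ℝ :=
  (∑ i, (D i : ℝ)) / n

/-- The excess `(r / (n β) - 1)₊`. -/
def excess (n : ℕ) (r β : ℝ) : ℝ := max (r / (n * β) - 1) 0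

/-- The rate `(δ / (1 + δ))³ r² ∨ r² / n` with `δ = (r / (n β) - 1)₊`. -/
def rate (n : ℕ) (r β : ℝ) : ℝ :=
  max ((excess n r β / (1 + excess n r β)) ^ 3 * r ^ 2) (r ^ 2 / n)

/-- The data-dependent shrinkage estimator. When the sample mean is `0` the estimate is `0`,
whatever value is given to the quotient by `|sampleMean|`. -/
def shrinkageEstimator (n : ℕ) (r β : ℝ) (z : (Fin n → Ball r) × I) : ℝ :=
  (1 - min (excess n r β) 1 *
      min ((2 * r * √(excess n r β) + 2 * r / √(n : ℝ)) / |sampleMean z.1|) 1) *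
    sampleMean z.1

end Bounded

end StableMean

end

/-! Lower bound. Restrict to laws on `{-r, r}` with mean `r * t`. Clipping and averaging over the
seed turn an estimator into a function `G` of `n` signs, with no loss of stability or risk. The
derivative of its expectation in `t` is the covariance of `G` with the score. By exchangeability of
`n + 1` signs this covariance is an average of the differences that stability controls
(`succ_mul_cubeMean_mul_centeredSum`). With `κ = δ / (1 + δ)`, an active constraint says `n β = r (1
- κ)`. If also `n κ ≥ 4`, the slope stays below `r (1 - κ / 2)` for `|t| ≤ √κ / 2`, the range where
the factor `1 / (1 - t²)` is harmless. The true slope is `r`, so a bias of order `κ √κ r` builds up,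
and its square is the rate `κ³ r²`. Bounding the same covariance by Cauchy–Schwarz gives `r² / n`.

Upper bound. The estimator is `x - m * clip a x` at the sample mean `x`. It contracts differences
only for `|x| ≤ a`, which suffices: a sample with a large mean has little spread (`sum_abs_sub_le`),
so the sample mean is already stable there. The bias is at most `m * min a r`, and the variance of
the sample mean is at most `r² / n`. -/

namespace StableMean

/-! ### Independent signs: score identity and lower bounds. -/

section BernoulliCube

variable {n : ℕ}

/-- The sign `±1` encoded by a Boolean. -/
noncomputable def boolSign (b : Bool) : ℝ := if b then 1 else -1

/-- The mass given to a sign by the distribution on `{-1, 1}` with mean `t`. -/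
noncomputable def signWeight (t : ℝ) (b : Bool) : ℝ := (1 + boolSign b * t) / 2

/-- The mass given to a vector of signs by the product distribution with mean `(t, …, t)`. -/
noncomputable def cubeWeight (t : ℝ) (x : Fin n → Bool) : ℝ := ∏ i, signWeight t (x i)

/-- The expectation over independent signs with mean `t`. -/
noncomputable def cubeMean (t : ℝ) (G : (Fin n → Bool) → ℝ) : ℝ := ∑ x, cubeWeight t x * G x

/-- The sum of the centered signs, proportional to the score of the sign model. -/
noncomputable def centeredSum (t : ℝ) (x : Fin n → Bool) : ℝ := ∑ k, (boolSign (x k) - t)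

lemma signWeight_nonneg {t : ℝ} (ht : |t| ≤ 1) (b : Bool) : 0 ≤ signWeight t b := by
  have := abs_le.1 ht
  cases b <;> simp [signWeight, boolSign] <;> linarith

lemma cubeWeight_nonneg {t : ℝ} (ht : |t| ≤ 1) (x : Fin n → Bool) : 0 ≤ cubeWeight t x :=
  Finset.prod_nonneg fun _ _ => signWeight_nonneg ht _

lemma sum_signWeight (t : ℝ) : ∑ b, signWeight t b = 1 := by
  simp [signWeight, boolSign]; ring

lemma sum_cube_succ (i : Fin (n + 1)) (F : (Fin (n + 1) → Bool) → ℝ) :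
    ∑ x, F x = ∑ b, ∑ x : Fin n → Bool, F (i.insertNth b x) := by
  rw [← Fintype.sum_prod_type']
  exact (Fintype.sum_equiv (Fin.insertNthEquiv (fun _ => Bool) i) _ _ fun _ => rfl).symm

lemma cubeWeight_insertNth (t : ℝ) (i : Fin (n + 1)) (b : Bool) (x : Fin n → Bool) :
    cubeWeight t (i.insertNth b x : Fin (n + 1) → Bool) = signWeight t b * cubeWeight t x := by
  simp [cubeWeight, Fin.prod_univ_succAbove _ i]

/-- Fubini in one coordinate. An arbitrary `i` is needed because stability deletes an arbitrary
point. -/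
lemma cubeMean_succ (t : ℝ) (i : Fin (n + 1)) (G : (Fin (n + 1) → Bool) → ℝ) :
    cubeMean t G = cubeMean t fun x => ∑ b, signWeight t b * G (i.insertNth b x) := by
  simp only [cubeMean, sum_cube_succ i, cubeWeight_insertNth, Finset.mul_sum]
  rw [Finset.sum_comm]
  exact Finset.sum_congr rfl fun _ _ => Finset.sum_congr rfl fun _ _ => by ring

lemma cubeMean_add (t : ℝ) (F G : (Fin n → Bool) → ℝ) :
    (cubeMean t fun x => F x + G x) = cubeMean t F + cubeMean t G := by
  simp [cubeMean, mul_add, Finset.sum_add_distrib]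

lemma cubeMean_const_mul (t c : ℝ) (G : (Fin n → Bool) → ℝ) :
    (cubeMean t fun x => c * G x) = c * cubeMean t G := by
  simp only [cubeMean, Finset.mul_sum]
  exact Finset.sum_congr rfl fun _ _ => by ring

lemma cubeMean_mono {t : ℝ} (ht : |t| ≤ 1) {F G : (Fin n → Bool) → ℝ} (h : ∀ x, F x ≤ G x) :
    cubeMean t F ≤ cubeMean t G :=
  Finset.sum_le_sum fun x _ => mul_le_mul_of_nonneg_left (h x) (cubeWeight_nonneg ht x)

lemma cubeMean_const (t c : ℝ) : (cubeMean t fun _ : Fin n → Bool => c) = c := by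
  have h1 : (cubeMean t fun _ : Fin n → Bool => (1 : ℝ)) = 1 := by
    induction n with
    | zero => simp [cubeMean, cubeWeight]
    | succ n ih => rw [cubeMean_succ t 0]; simp only [mul_one, sum_signWeight, ih]
  simpa [h1] using cubeMean_const_mul t c fun _ : Fin n → Bool => (1 : ℝ)

lemma centeredSum_insertNth (t : ℝ) (b : Bool) (x : Fin n → Bool) :
    centeredSum t (Fin.insertNth 0 b x : Fin (n + 1) → Bool) =
      (boolSign b - t) + centeredSum t x := by
  simp only [centeredSum, Fin.sum_univ_succAbove _ (0 : Fin (n + 1)), Fin.insertNth_apply_same,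
    Fin.insertNth_apply_succAbove]

lemma cubeMean_centeredSum (t : ℝ) : cubeMean t (centeredSum (n := n) t) = 0 := by
  induction n with
  | zero => simp [cubeMean, centeredSum]
  | succ n ih =>
    rw [cubeMean_succ t 0, ← ih]
    congr 1; ext x
    simp only [centeredSum_insertNth, Fintype.sum_bool]
    simp [signWeight, boolSign]; ring

lemma cubeMean_centeredSum_sq (t : ℝ) :
    (cubeMean t fun x : Fin n → Bool => centeredSum t x ^ 2) = n * (1 - t ^ 2) := by
  induction n with
  | zero => simp [cubeMean, centeredSum]
  | succ n ih =>
    rw [cubeMean_succ t 0]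
    have : (fun x : Fin n → Bool => ∑ b, signWeight t b *
        centeredSum t (Fin.insertNth 0 b x : Fin (n + 1) → Bool) ^ 2) =
        fun x => (1 - t ^ 2) + centeredSum t x ^ 2 := by
      ext x
      simp only [centeredSum_insertNth, Fintype.sum_bool]
      simp [signWeight, boolSign]; ring
    rw [this, cubeMean_add, cubeMean_const, ih]
    push_cast; ring

lemma cubeMean_mul_sq_le {t : ℝ} (ht : |t| ≤ 1) (F G : (Fin n → Bool) → ℝ) :
    (cubeMean t fun x => F x * G x) ^ 2 ≤
      (cubeMean t fun x => F x ^ 2) * cubeMean t fun x => G x ^ 2 := by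
  refine Finset.sum_sq_le_sum_mul_sum_of_sq_le_mul _
    (fun x _ => mul_nonneg (cubeWeight_nonneg ht x) (sq_nonneg _))
    (fun x _ => mul_nonneg (cubeWeight_nonneg ht x) (sq_nonneg _)) fun x _ => by rw [mul_pow, mul_pow, sq (cubeWeight t x)]; exact (by ring : _ = _).le

/-- The squared bias is at most the mean-square error, by Cauchy–Schwarz against the constant 1. -/
lemma sub_sq_cubeMean_le {t : ℝ} (ht : |t| ≤ 1) (G : (Fin n → Bool) → ℝ) (c : ℝ) :
    (cubeMean t G - c) ^ 2 ≤ cubeMean t fun x => (G x - c) ^ 2 := by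
  have h := cubeMean_mul_sq_le ht (fun x => G x - c) fun _ => 1
  have h2 : cubeMean t (fun x => G x - c) = cubeMean t G - c := by
    simp only [sub_eq_add_neg, cubeMean_add, cubeMean_const]
  simpa only [mul_one, one_pow, cubeMean_const, h2] using h

/-- Each factor has logarithmic derivative `s / (1 + s t) = (s - t) / (1 - t²)`, since a sign
satisfies `s² = 1`. -/
lemma hasDerivAt_cubeWeight {t : ℝ} (ht : t ^ 2 < 1) (x : Fin n → Bool) :
    HasDerivAt (fun t => cubeWeight t x) (cubeWeight t x * centeredSum t x / (1 - t ^ 2)) t := by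
  have h1 (i : Fin n) : HasDerivAt (fun t => signWeight t (x i)) (boolSign (x i) / 2) t := by
    have := (((hasDerivAt_id t).const_mul (boolSign (x i))).const_add 1).div_const 2
    simpa [signWeight] using this
  refine (HasDerivAt.fun_finsetProd (u := Finset.univ) fun i _ => h1 i).congr_deriv (Eq.symm ?_)
  have h0 : 1 - t ^ 2 ≠ 0 := by linarith
  rw [centeredSum, Finset.mul_sum, Finset.sum_div]
  refine Finset.sum_congr rfl fun i _ => ?_
  rw [cubeWeight, ← Finset.prod_erase_mul _ _ (Finset.mem_univ i), smul_eq_mul, mul_assoc,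
    mul_div_assoc]
  congr 1
  rw [div_eq_iff h0]
  cases x i <;> simp [signWeight, boolSign] <;> ring

/-- Differentiating an expectation produces the covariance with the score. -/
lemma hasDerivAt_cubeMean {t : ℝ} (ht : t ^ 2 < 1) (G : (Fin n → Bool) → ℝ) :
    HasDerivAt (fun t => cubeMean t G)
      ((cubeMean t fun x => G x * centeredSum t x) / (1 - t ^ 2)) t := by
  unfold cubeMean
  refine (HasDerivAt.fun_sum (u := Finset.univ)
    fun x _ => (hasDerivAt_cubeWeight ht x).mul_const (G x)).congr_deriv (Eq.symm ?_)
  rw [Finset.sum_div]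
  exact Finset.sum_congr rfl fun x _ => by ring

/-- The covariance of `G` with the score is controlled by its mean-square error. -/
lemma cubeMean_mul_centeredSum_sq_le {t : ℝ} (ht : |t| ≤ 1) (G : (Fin n → Bool) → ℝ) (c : ℝ) :
    (cubeMean t fun x => G x * centeredSum t x) ^ 2 ≤
      (cubeMean t fun x => (G x - c) ^ 2) * (n * (1 - t ^ 2)) := by
  have h := cubeMean_mul_sq_le ht (fun x => G x - c) (centeredSum t)
  rw [cubeMean_centeredSum_sq] at h
  have h2 : (cubeMean t fun x => (G x - c) * centeredSum t x) =
      cubeMean t fun x => G x * centeredSum t x := by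
    have h3 := cubeMean_const_mul (n := n) t (-c) (centeredSum t)
    simp only [sub_eq_add_neg, cubeMean_add, add_mul, h3, cubeMean_centeredSum, mul_zero, add_zero]
  rwa [h2] at h

/-- The covariance of `G` with the score is a mean of the differences between the values of `G` at
leave-one-out subvectors of a vector of `n + 1` signs. -/
lemma succ_mul_cubeMean_mul_centeredSum (t : ℝ) (G : (Fin n → Bool) → ℝ) :
    ((n : ℝ) + 1) * cubeMean t (fun x => G x * centeredSum t x) =
      cubeMean t fun D : Fin (n + 1) → Bool => ∑ i, ∑ j,
        (boolSign (D j) - boolSign (D i)) / 2 * (G (i.removeNth D) - G (j.removeNth D)) := by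
  -- Given the other signs, `D i` averages to `t`; the term `j = i` vanishes, and the remaining sum
  -- is the centered sum of the vector without `D i`.
  have hi (i : Fin (n + 1)) : (cubeMean t fun D : Fin (n + 1) → Bool =>
      ∑ j, (boolSign (D j) - boolSign (D i)) * G (i.removeNth D)) =
      cubeMean t fun x => G x * centeredSum t x := by
    rw [cubeMean_succ t i]
    congr 1; ext x
    simp only [Fin.sum_univ_succAbove _ i, Fin.insertNth_apply_same,
      Fin.insertNth_apply_succAbove, Fin.removeNth_insertNth, ← Finset.sum_mul, centeredSum,
      Fintype.sum_bool, Finset.sum_sub_distrib]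
    simp [signWeight, boolSign]; ring
  -- The weight is antisymmetric in `i` and `j`, so swapping them shows that both halves contribute
  -- equally.
  have hs (D : Fin (n + 1) → Bool) : ∑ i, ∑ j,
        (boolSign (D j) - boolSign (D i)) / 2 * (G (i.removeNth D) - G (j.removeNth D)) =
      ∑ i, ∑ j, (boolSign (D j) - boolSign (D i)) * G (i.removeNth D) := by
    have h1 : ∑ i, ∑ j, (boolSign (D j) - boolSign (D i)) / 2 * G (j.removeNth D) =
        - ∑ i, ∑ j, (boolSign (D j) - boolSign (D i)) / 2 * G (i.removeNth D) := by
      rw [Finset.sum_comm, ← Finset.sum_neg_distrib]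
      refine Finset.sum_congr rfl fun i _ => ?_
      rw [← Finset.sum_neg_distrib]
      exact Finset.sum_congr rfl fun j _ => by ring
    simp only [mul_sub, Finset.sum_sub_distrib, h1]
    rw [sub_neg_eq_add, ← two_mul, Finset.mul_sum]
    refine Finset.sum_congr rfl fun i _ => ?_
    rw [Finset.mul_sum]
    exact Finset.sum_congr rfl fun j _ => by ring
  simp only [hs]
  have hsum (F : Fin (n + 1) → (Fin (n + 1) → Bool) → ℝ) :
      (cubeMean t fun D => ∑ i, F i D) = ∑ i, cubeMean t (F i) := by
    simp only [cubeMean, Finset.mul_sum]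
    exact Finset.sum_comm
  rw [hsum]
  simp only [hi]
  simp

/-- In the leave-one-out identity the weights `(D j - D i) / 2` lie in `[-1, 1]`, so stability
bounds the sum for every `D`. -/
lemma cubeMean_mul_centeredSum_le_of_stable {t b : ℝ} (ht : |t| ≤ 1) {G : (Fin n → Bool) → ℝ}
    (hG : ∀ D : Fin (n + 1) → Bool,
      ∑ i : Fin (n + 1), ∑ j : Fin (n + 1), |G (i.removeNth D) - G (j.removeNth D)| ≤ b * ((n : ℝ) + 1) ^ 2) :
    (cubeMean t fun x => G x * centeredSum t x) ≤ b * (n + 1) := by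
  have h : ((n : ℝ) + 1) * cubeMean t (fun x => G x * centeredSum t x) ≤
      b * ((n : ℝ) + 1) ^ 2 := by
    rw [succ_mul_cubeMean_mul_centeredSum, ← cubeMean_const t (b * ((n : ℝ) + 1) ^ 2)]
    refine cubeMean_mono ht fun D => le_trans ?_ (hG D)
    refine Finset.sum_le_sum fun i _ => Finset.sum_le_sum fun j _ => ?_
    refine (le_abs_self _).trans ?_
    rw [abs_mul]
    refine mul_le_of_le_one_left (abs_nonneg _) ?_
    cases D i <;> cases D j <;> norm_num [boolSign]
  have hn : (0 : ℝ) < n + 1 := by positivity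
  refine le_of_mul_le_mul_left ?_ hn
  linarith

/-- If the expectation of `G` grows more slowly than the parameter `r * t`, then `G` has a
large mean-square error somewhere. -/
lemma le_of_deriv_cubeMean_le {r τ L R : ℝ} (h0 : 0 ≤ τ) (h1 : τ < 1) {G : (Fin n → Bool) → ℝ}
    (hR : ∀ t, |t| ≤ τ → (cubeMean t fun x => (G x - r * t) ^ 2) ≤ R)
    (hL : ∀ t, |t| ≤ τ → (cubeMean t fun x => G x * centeredSum t x) / (1 - t ^ 2) ≤ L) :
    τ * (r - L) ≤ √R := by
  have hb (t : ℝ) (ht : |t| ≤ τ) : |cubeMean t G - r * t| ≤ √R :=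
    Real.abs_le_sqrt ((sub_sq_cubeMean_le (by linarith) G _).trans (hR t ht))
  have hd (t : ℝ) (ht : t ∈ Set.Icc (-τ) τ) := hasDerivAt_cubeMean (t := t)
    ((sq_lt_one_iff_abs_lt_one t).2 (by have := abs_le.2 ht; linarith)) G
  -- The expectation of `G` rises by at most `2 τ L` from `-τ` to `τ`, but being within `√R` of `r *
  -- t` at both ends forces a rise of at least `2 τ r - 2 √R`.
  have hm := (convex_Icc (-τ) τ).image_sub_le_mul_sub_of_deriv_le
    (f := fun t => cubeMean t G) (C := L)
    (fun t ht => (hd t ht).continuousAt.continuousWithinAt)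
    (fun t ht => (hd t (interior_subset ht)).differentiableAt.differentiableWithinAt)
    (fun t ht => by
      rw [(hd t (interior_subset ht)).deriv]
      exact hL t (abs_le.2 (Set.mem_Icc.1 (interior_subset ht))))
    (-τ) ⟨le_rfl, by linarith⟩ τ ⟨by linarith, le_rfl⟩ (by linarith)
  have h2 := abs_le.1 (hb τ (abs_of_nonneg h0).le)
  have h3 := abs_le.1 (hb (-τ) (by rw [abs_neg, abs_of_nonneg h0]))
  nlinarith

/-- No function of `n` signs estimates their common mean at a rate better than `1 / n`. -/
lemma parametric_cube_lower_bound {r R : ℝ} (hn : 0 < n) (hr : 0 < r) {G : (Fin n → Bool) → ℝ}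
    (hR : ∀ t, |t| < 1 → (cubeMean t fun x => (G x - r * t) ^ 2) ≤ R) :
    r ^ 2 / n ≤ 16 * R := by
  have hn' : (1 : ℝ) ≤ n := by exact_mod_cast hn
  have hR0 : 0 ≤ R := by
    refine le_trans ?_ (hR 0 (by simp))
    exact Finset.sum_nonneg fun x _ => mul_nonneg (cubeWeight_nonneg (by simp) x) (sq_nonneg _)
  -- Cauchy–Schwarz bounds the slope by `√(n R / (1 - t²))`, which is below `2 √(n R)` on this
  -- range.
  have h := le_of_deriv_cubeMean_le (r := r) (τ := 1 / 2) (L := 2 * √(n * R)) (R := R) (G := G)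
    (by norm_num) (by norm_num) (fun t ht => hR t (by linarith)) fun t ht => by
      have ht2 : t ^ 2 ≤ 1 / 4 := by
        have := abs_le.1 ht
        nlinarith
      have hpos : 0 < 1 - t ^ 2 := by linarith
      have hc := cubeMean_mul_centeredSum_sq_le (t := t) (by linarith) G (r * t)
      rw [div_le_iff₀ hpos]
      refine le_of_sq_le_sq ?_ (by positivity)
      refine hc.trans ?_
      rw [mul_pow, mul_pow, Real.sq_sqrt (by positivity)]
      have := hR t (by linarith)
      calc (cubeMean t fun x => (G x - r * t) ^ 2) * (n * (1 - t ^ 2))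
          ≤ R * (n * (1 - t ^ 2)) := by gcongr
        _ ≤ 2 ^ 2 * (n * R) * (1 - t ^ 2) ^ 2 := by
          have : 0 ≤ n * R * (1 - t ^ 2) := by positivity
          nlinarith
  have h2 : √R ≤ √(n * R) := Real.sqrt_le_sqrt (le_mul_of_one_le_left hR0 hn')
  have h3 : r ≤ 4 * √(n * R) := by linarith
  have h4 : r ^ 2 ≤ (4 * √(n * R)) ^ 2 := by gcongr
  rw [mul_pow, Real.sq_sqrt (by positivity)] at h4
  rw [div_le_iff₀ (by linarith)]
  linarith

/-- A stable function of `n` signs underestimates the variation of their common mean. -/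
lemma stable_cube_lower_bound {r b κ R : ℝ} (hr : 0 < r) (hn : 0 < n) (hκ : κ ≤ 1)
    (hκn : 4 ≤ n * κ) (hb : n * b ≤ r * (1 - κ)) {G : (Fin n → Bool) → ℝ}
    (hG : ∀ D : Fin (n + 1) → Bool,
      ∑ i : Fin (n + 1), ∑ j : Fin (n + 1), |G (i.removeNth D) - G (j.removeNth D)| ≤ b * ((n : ℝ) + 1) ^ 2)
    (hR : ∀ t, |t| < 1 → (cubeMean t fun x => (G x - r * t) ^ 2) ≤ R) :
    κ ^ 3 * r ^ 2 ≤ 16 * R := by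
  have hn' : (1 : ℝ) ≤ n := by exact_mod_cast hn
  have hκ0 : 0 < κ := by
    by_contra! h
    nlinarith
  have hR0 : 0 ≤ R := by
    refine le_trans ?_ (hR 0 (by simp))
    exact Finset.sum_nonneg fun x _ => mul_nonneg (cubeWeight_nonneg (by simp) x) (sq_nonneg _)
  have hs : √κ ^ 2 = κ := Real.sq_sqrt hκ0.le
  have hs1 : √κ ≤ 1 := Real.sqrt_le_one.2 hκ
  have hs0 : 0 ≤ √κ := Real.sqrt_nonneg κ
  -- Of the slope deficit `κ`, a quarter pays for replacing `n` by `n + 1` (this uses `n κ ≥ 4`) and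
  -- a quarter for `1 - t² ≥ 1 - κ / 4`; half remains.
  have h := le_of_deriv_cubeMean_le (r := r) (τ := √κ / 2) (L := r * (1 - κ / 2)) (R := R) (G := G)
    (by positivity) (by linarith) (fun t ht => hR t (by linarith)) fun t ht => by
      have ht2 : t ^ 2 ≤ κ / 4 := by
        have := abs_le.1 ht
        nlinarith
      have hpos : 0 < 1 - t ^ 2 := by linarith
      rw [div_le_iff₀ hpos]
      refine (cubeMean_mul_centeredSum_le_of_stable (by linarith) hG).trans ?_
      have h1 : n * (b * (n + 1)) ≤ n * (r * (1 - 3 * κ / 4)) := by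
        have : n * b * (n + 1) ≤ r * (1 - κ) * (n + 1) := by gcongr
        nlinarith [mul_pos hr hκ0]
      have h2 := le_of_mul_le_mul_left h1 (by linarith)
      have h3 : r * (1 - 3 * κ / 4) ≤ r * (1 - κ / 2) * (1 - κ / 4) := by nlinarith [sq_nonneg κ]
      have h4 : r * (1 - κ / 2) * (1 - κ / 4) ≤ r * (1 - κ / 2) * (1 - t ^ 2) := by
        have : 0 ≤ r * (1 - κ / 2) := mul_nonneg hr.le (by linarith)
        gcongr
      linarith
  have h2 : (√κ / 2 * (r - r * (1 - κ / 2))) ^ 2 ≤ √R ^ 2 := by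
    have : 0 ≤ √κ / 2 * (r - r * (1 - κ / 2)) := by
      have : r - r * (1 - κ / 2) = r * κ / 2 := by ring
      rw [this]; positivity
    gcongr
  rw [Real.sq_sqrt hR0] at h2
  have : (√κ / 2 * (r - r * (1 - κ / 2))) ^ 2 = √κ ^ 2 * κ ^ 2 * r ^ 2 / 16 := by ring
  rw [this, hs] at h2
  linarith [show κ ^ 3 * r ^ 2 = κ * κ ^ 2 * r ^ 2 by ring]

end BernoulliCube

/-! ### Stability without the normalizing factor. -/

section Stability

variable {𝒳 : Type*} {n : ℕ}

lemma isAverageCaseStable_iff {f : (Fin n → 𝒳) × I → ℝ} {β : ℝ} :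
    IsAverageCaseStable f (ENNReal.ofReal β) ↔ ∀ D : Fin (n + 1) → 𝒳,
      ∑ i : Fin (n + 1), ∑ j : Fin (n + 1),
        ∫⁻ ξ : I, ‖f (i.removeNth D, ξ) - f (j.removeNth D, ξ)‖ₑ ≤
          ENNReal.ofReal (β * ((n : ℝ) + 1) ^ 2) := by
  have h : ENNReal.ofReal (β * ((n : ℝ) + 1) ^ 2) =
      ((n : ℝ≥0∞) + 1) ^ 2 * ENNReal.ofReal β := by
    rw [mul_comm, ENNReal.ofReal_mul (by positivity), ENNReal.ofReal_pow (by positivity)]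
    congr 2
    exact_mod_cast ENNReal.ofReal_natCast (n + 1)
  rw [IsAverageCaseStable, ENNReal.inv_mul_le_iff (by simp) (by finiteness), ← h, iSup_le_iff]

end Stability

/-! ### Projection onto an interval. -/

section Clip

/-- The projection of the real line onto `[-a, a]`. -/
noncomputable def clip (a x : ℝ) : ℝ := max (-a) (min a x)

lemma abs_clip_le {a : ℝ} (ha : 0 ≤ a) (x : ℝ) : |clip a x| ≤ a :=
  abs_le.2 ⟨le_max_left _ _, max_le (by linarith) (min_le_left _ _)⟩

lemma abs_clip_le_abs {a : ℝ} (ha : 0 ≤ a) (x : ℝ) : |clip a x| ≤ |x| := by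
  have := neg_abs_le x
  have := le_abs_self x
  have := abs_nonneg x
  refine abs_le.2 ⟨?_, max_le (by linarith) ((min_le_right _ _).trans (le_abs_self x))⟩
  exact le_max_of_le_right (le_min (by linarith) (neg_abs_le x))

lemma clip_eq_self {a x : ℝ} (hx : |x| ≤ a) : clip a x = x := by
  have := abs_le.1 hx
  rw [clip, min_eq_right this.2, max_eq_right this.1]

lemma clip_mono (a : ℝ) : Monotone (clip a) := fun _ _ h =>
  max_le_max le_rfl (min_le_min le_rfl h)

lemma abs_clip_sub_clip_le (a x y : ℝ) : |clip a x - clip a y| ≤ |x - y| := by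
  unfold clip
  rw [max_comm, max_comm (-a), min_comm, min_comm a]
  exact (abs_max_sub_max_le_abs _ _ _).trans <|
    (abs_min_sub_min_le_max _ _ _ _).trans (by simp)

@[fun_prop]
lemma measurable_clip (a : ℝ) : Measurable (clip a) := by
  unfold clip; fun_prop

end Clip

/-! ### Reduction from estimators to functions of signs. -/

section TwoPoint

variable {n : ℕ} {r : ℝ}

/-- The endpoints `±r` of the interval `[-r, r]`. -/
noncomputable def endpoint (hr : 0 < r) (b : Bool) : Ball r :=
  ⟨boolSign b * r, by cases b <;> simp [boolSign, abs_of_pos hr]⟩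

lemma endpoint_injective (hr : 0 < r) : Function.Injective (endpoint hr) := by
  intro b b' h
  have h' : boolSign b * r = boolSign b' * r := congrArg Subtype.val h
  have h2 := mul_right_cancel₀ hr.ne' h'
  cases b <;> cases b' <;> simp [boolSign] at h2 ⊢ <;> linarith

/-- The measure supported on `{-r, r}` with mean `r * t`. -/
noncomputable def twoPointMeasure (hr : 0 < r) (t : ℝ) : Measure (Ball r) :=
  ENNReal.ofReal (signWeight t true) • Measure.dirac (endpoint hr true) +
    ENNReal.ofReal (signWeight t false) • Measure.dirac (endpoint hr false)

lemma isProbabilityMeasure_twoPointMeasure (hr : 0 < r) {t : ℝ} (ht : |t| ≤ 1) :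
    IsProbabilityMeasure (twoPointMeasure hr t) := by
  constructor
  have := sum_signWeight t
  rw [Fintype.sum_bool] at this
  simp [twoPointMeasure, ← ENNReal.ofReal_add (signWeight_nonneg ht _) (signWeight_nonneg ht _),
    this]

/-- The distribution supported on `{-r, r}` with mean `r * t`. -/
noncomputable def twoPoint (hr : 0 < r) {t : ℝ} (ht : |t| ≤ 1) : ProbabilityMeasure (Ball r) :=
  ⟨twoPointMeasure hr t, isProbabilityMeasure_twoPointMeasure hr ht⟩

lemma mean_twoPoint (hr : 0 < r) {t : ℝ} (ht : |t| ≤ 1) : mean (twoPoint hr ht) = r * t := by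
  have hi (b : Bool) : Integrable (fun x : Ball r => (x : ℝ))
      (ENNReal.ofReal (signWeight t b) • Measure.dirac (endpoint hr b)) :=
    (integrable_dirac (by simp)).smul_measure (by finiteness)
  rw [mean, twoPoint, ProbabilityMeasure.coe_mk, twoPointMeasure,
    integral_add_measure (hi true) (hi false),
    integral_smul_measure, integral_smul_measure, integral_dirac, integral_dirac,
    ENNReal.toReal_ofReal (signWeight_nonneg ht _), ENNReal.toReal_ofReal (signWeight_nonneg ht _)]
  simp [endpoint, signWeight, boolSign]; ring

lemma ofReal_signWeight_le (hr : 0 < r) {t : ℝ} (b : Bool) :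
    ENNReal.ofReal (signWeight t b) ≤ twoPointMeasure hr t {endpoint hr b} := by
  cases b <;> simp [twoPointMeasure]

lemma ofReal_cubeMean_le_lintegral (hr : 0 < r) {t : ℝ} (ht : |t| ≤ 1)
    {H : (Fin n → Bool) → ℝ} (hH : ∀ x, 0 ≤ H x) {F : (Fin n → Ball r) → ℝ≥0∞}
    (hF : ∀ x, ENNReal.ofReal (H x) ≤ F fun i => endpoint hr (x i)) :
    ENNReal.ofReal (cubeMean t H) ≤
      ∫⁻ z, F z ∂(Measure.pi fun _ : Fin n => twoPointMeasure hr t) := by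
  have := isProbabilityMeasure_twoPointMeasure hr ht
  let e : (Fin n → Bool) ↪ (Fin n → Ball r) :=
    ⟨fun x i => endpoint hr (x i), (endpoint_injective hr).comp_left⟩
  -- Only a lower bound is needed, so it is enough to integrate over the finitely many sign vectors,
  -- each with at least its product mass.
  refine le_trans ?_ (setLIntegral_le_lintegral (Finset.univ.map e : Set (Fin n → Ball r)) F)
  rw [lintegral_finset, Finset.sum_map, cubeMean,
    ENNReal.ofReal_sum_of_nonneg fun x _ => mul_nonneg (cubeWeight_nonneg ht x) (hH x)]
  refine Finset.sum_le_sum fun x _ => ?_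
  rw [ENNReal.ofReal_mul (cubeWeight_nonneg ht x), mul_comm]
  refine mul_le_mul' (hF x) ?_
  have hx : ({e x} : Set (Fin n → Ball r)) = Set.univ.pi fun i => {endpoint hr (x i)} :=
    (Set.univ_pi_singleton _).symm
  rw [hx, Measure.pi_pi, cubeWeight,
    ENNReal.ofReal_prod_of_nonneg fun i _ => signWeight_nonneg ht _]
  exact Finset.prod_le_prod' fun i _ => ofReal_signWeight_le hr _

/-- The clipped estimator, averaged over the seed, on data sets contained in `{-r, r}`. -/
noncomputable def signEstimator (hr : 0 < r) (f : (Fin n → Ball r) × I → ℝ) (x : Fin n → Bool) :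
    ℝ :=
  ∫ ξ : I, clip r (f (fun i => endpoint hr (x i), ξ))

/-- Clipping makes the average over the seed meaningful: `f` itself need not be integrable in the
seed. -/
lemma integrable_clip (hr : 0 < r) {f : (Fin n → Ball r) × I → ℝ} (hf : Measurable f)
    (z : Fin n → Ball r) : Integrable fun ξ : I => clip r (f (z, ξ)) :=
  Integrable.of_bound (Measurable.aestronglyMeasurable (by fun_prop)) r (.of_forall fun _ => abs_clip_le hr.le _)

/-- Clipping is 1-Lipschitz and averaging over the seed does not increase absolute differences. -/
lemma sum_abs_signEstimator_le (hr : 0 < r) {β : ℝ} (hβ : 0 < β)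
    {f : (Fin n → Ball r) × I → ℝ} (hf : Measurable f)
    (hs : IsAverageCaseStable f (ENNReal.ofReal β)) (D : Fin (n + 1) → Bool) :
    ∑ i : Fin (n + 1), ∑ j : Fin (n + 1),
      |signEstimator hr f (i.removeNth D) - signEstimator hr f (j.removeNth D)| ≤
        β * ((n : ℝ) + 1) ^ 2 := by
  rw [← ENNReal.ofReal_le_ofReal_iff (by positivity),
    ENNReal.ofReal_sum_of_nonneg fun i _ => Finset.sum_nonneg fun j _ => abs_nonneg _]
  refine le_trans (Finset.sum_le_sum fun i _ => ?_)
    (isAverageCaseStable_iff.1 hs fun i => endpoint hr (D i))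
  rw [ENNReal.ofReal_sum_of_nonneg fun j _ => abs_nonneg _]
  refine Finset.sum_le_sum fun j _ => ?_
  rw [signEstimator, signEstimator,
    ← integral_sub (integrable_clip hr hf _) (integrable_clip hr hf _), ← Real.enorm_eq_ofReal_abs]
  refine (enorm_integral_le_lintegral_enorm _).trans (lintegral_mono fun ξ => ?_)
  rw [Real.enorm_eq_ofReal_abs, Real.enorm_eq_ofReal_abs]
  exact ENNReal.ofReal_le_ofReal (abs_clip_sub_clip_le _ _ _)

/-- Averaging over the seed lowers the squared error by Jensen; clipping lowers it because `r * t`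
is fixed by the projection. -/
lemma ofReal_cubeMean_signEstimator_le_risk (hr : 0 < r) {t : ℝ} (ht : |t| ≤ 1)
    {f : (Fin n → Ball r) × I → ℝ} (hf : Measurable f) :
    ENNReal.ofReal (cubeMean t fun x => (signEstimator hr f x - r * t) ^ 2) ≤
      risk mean f (twoPoint hr ht) := by
  have := isProbabilityMeasure_twoPointMeasure hr ht
  rw [risk, lintegral_prod _ (by fun_prop), mean_twoPoint]
  refine ofReal_cubeMean_le_lintegral hr ht (fun _ => sq_nonneg _) fun x => ?_
  have hrt : |r * t| ≤ r := by
    rw [abs_mul, abs_of_pos hr]; exact mul_le_of_le_one_right hr.le ht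
  have hi := integrable_clip hr hf fun i => endpoint hr (x i)
  have h2 : signEstimator hr f x - r * t =
      ∫ ξ : I, (clip r (f (fun i => endpoint hr (x i), ξ)) - r * t) := by
    rw [integral_sub hi (integrable_const _)]; simp [signEstimator]
  have h3 : Integrable (fun ξ : I => (clip r (f (fun i => endpoint hr (x i), ξ)) - r * t) ^ 2) := by
    refine Integrable.of_bound (Measurable.aestronglyMeasurable (by fun_prop)) ((2 * r) ^ 2) (.of_forall fun ξ => ?_)
    rw [Real.norm_eq_abs, abs_pow]
    have h4 := abs_clip_le hr.le (f (fun i => endpoint hr (x i), ξ))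
    gcongr
    exact (abs_sub _ _).trans (by linarith)
  have hJ : (signEstimator hr f x - r * t) ^ 2 ≤
      ∫ ξ : I, (clip r (f (fun i => endpoint hr (x i), ξ)) - r * t) ^ 2 := by
    rw [h2]
    exact (even_two.convexOn_pow (𝕜 := ℝ)).map_integral_le (by fun_prop) isClosed_univ
      (by simp) (hi.sub (integrable_const _)) h3
  refine (ENNReal.ofReal_le_ofReal hJ).trans ?_
  rw [ofReal_integral_eq_lintegral_ofReal h3 (.of_forall fun _ => sq_nonneg _)]
  refine lintegral_mono fun ξ => ?_
  rw [Real.enorm_eq_ofReal_abs, ← ENNReal.ofReal_pow (abs_nonneg _)]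
  refine ENNReal.ofReal_le_ofReal ?_
  rw [sq_le_sq, abs_abs]
  have := abs_clip_sub_clip_le r (f (fun i => endpoint hr (x i), ξ)) (r * t)
  rwa [clip_eq_self hrt] at this

end TwoPoint

/-! ### The excess `δ`. -/

section Excess

variable {n : ℕ} {r β : ℝ}

lemma excess_nonneg : 0 ≤ excess n r β := le_max_right _ _

lemma le_mul_one_add_excess (hn : 0 < n) (hβ : 0 < β) : r ≤ n * β * (1 + excess n r β) := by
  have hn' : (0 : ℝ) < n := by exact_mod_cast hn
  have h : r / (n * β) - 1 ≤ excess n r β := le_max_left _ _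
  have : r / (n * β) ≤ 1 + excess n r β := by linarith
  rw [div_le_iff₀ (by positivity)] at this
  linarith

lemma excess_eq_zero_or (hn : 0 < n) (hβ : 0 < β) :
    excess n r β = 0 ∨ n * β * (1 + excess n r β) = r := by
  have hn' : (0 : ℝ) < n := by exact_mod_cast hn
  rcases le_total (r / (n * β) - 1) 0 with h | h
  · exact .inl (max_eq_right h)
  · right
    rw [excess, max_eq_left h]
    field_simp; ring

lemma rate_nonneg : 0 ≤ rate n r β := le_max_of_le_right (by positivity)

end Excess

/-! ### Minimax lower bound. -/

section LowerBound

variable {n : ℕ} {r β : ℝ}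

lemma rate_le_of_isAverageCaseStable (hn : 8 ≤ n) (hr : 0 < r) (hβ : 0 < β)
    {f : (Fin n → Ball r) × I → ℝ} (hf : Measurable f)
    (hs : IsAverageCaseStable f (ENNReal.ofReal β)) :
    ENNReal.ofReal (1 / 16 * rate n r β) ≤ maxRisk (boundedClass r) mean f := by
  by_cases htop : maxRisk (boundedClass r) mean f = ⊤
  · simp [htop]
  have hn' : (8 : ℝ) ≤ n := by exact_mod_cast hn
  rw [ENNReal.ofReal_le_iff_le_toReal htop]
  set R := (maxRisk (boundedClass r) mean f).toReal
  have hR (t : ℝ) (ht : |t| < 1) :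
      (cubeMean t fun x => (signEstimator hr f x - r * t) ^ 2) ≤ R := by
    rw [← ENNReal.ofReal_le_iff_le_toReal htop]
    refine (ofReal_cubeMean_signEstimator_le_risk hr ht.le hf).trans ?_
    exact le_iSup₂ (f := fun P (_ : P ∈ boundedClass r) => risk mean f P) _ (Set.mem_univ _)
  have hpar := parametric_cube_lower_bound (by lia) hr hR
  suffices h : rate n r β ≤ 16 * R by linarith
  refine max_le ?_ hpar
  set δ := excess n r β with hδ
  have hδ0 : 0 ≤ δ := excess_nonneg
  set κ := δ / (1 + δ) with hκ
  have hκ0 : 0 ≤ κ := by positivity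
  have hκ1 : κ ≤ 1 := by rw [hκ, div_le_one (by positivity)]; linarith
  -- If `n κ < 4`, then `n³ κ³ ≤ 64 ≤ n²` because `n ≥ 8`, so the cubic term is below the parametric
  -- rate.
  rcases lt_or_ge (n * κ) 4 with h4 | h4
  · refine le_trans ?_ hpar
    rw [le_div_iff₀ (by linarith)]
    have h5 : n * κ ^ 3 * (n ^ 2 : ℝ) ≤ 1 * (n ^ 2 : ℝ) := by
      have h6 : (n * κ) ^ 3 ≤ 4 ^ 3 := by gcongr
      nlinarith
    have h7 : n * κ ^ 3 ≤ 1 := le_of_mul_le_mul_right h5 (by positivity)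
    nlinarith [sq_nonneg r]
  · refine stable_cube_lower_bound hr (by lia) hκ1 h4 ?_
      (sum_abs_signEstimator_le hr hβ hf hs) hR
    -- Zero excess would give `κ = 0`, against `n κ ≥ 4`; otherwise `n β = r / (1 + δ) = r (1 - κ)`.
    rcases excess_eq_zero_or (r := r) (n := n) (by lia) hβ with h | h
    · rw [← hδ] at h
      rw [hκ, h] at h4
      norm_num at h4
    · rw [← h, ← hδ, hκ]
      field_simp
      linarith

lemma le_stableMinimaxRisk (hn : 8 ≤ n) (hr : 0 < r) (hβ : 0 < β) (Θ : Set ℝ) :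
    ENNReal.ofReal (1 / 16 * rate n r β) ≤
      stableMinimaxRisk (boundedClass r) mean Θ n (ENNReal.ofReal β) :=
  le_iInf fun _ => le_iInf fun hf => le_iInf fun hs =>
    rate_le_of_isAverageCaseStable hn hr hβ hf.measurable hs

end LowerBound

/-! ### Shrinkage on the real line. -/

section Shrink

/-- Subtracting a multiple of the projection onto `[-a, a]`. -/
noncomputable def shrink (m a x : ℝ) : ℝ := x - m * clip a x

variable {m a : ℝ}

lemma shrink_eq (ha : 0 ≤ a) (x : ℝ) : (1 - m * min (a / |x|) 1) * x = shrink m a x := by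
  rcases eq_or_ne x 0 with rfl | hx
  · simp [shrink, clip_eq_self (a := a) (x := 0) (by simpa)]
  have hx' : 0 < |x| := abs_pos.2 hx
  suffices min (a / |x|) 1 * x = clip a x by
    rw [shrink, ← this]; ring
  rcases le_total |x| a with h | h
  · rw [clip_eq_self h, min_eq_right ((one_le_div hx').2 h), one_mul]
  · rw [min_eq_left ((div_le_one hx').2 h), clip]
    rcases hx.lt_or_gt with h0 | h0
    · rw [abs_of_neg h0] at h ⊢
      rw [min_eq_right (by linarith), max_eq_left (by linarith)]
      field_simp
    · rw [abs_of_pos h0] at h ⊢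
      rw [min_eq_left h, max_eq_right (by linarith)]
      field_simp

/-- The slope is `1 - m` inside `[-a, a]` and `1` outside. -/
lemma abs_shrink_sub_shrink_le (h0 : 0 ≤ m) (h1 : m ≤ 1) (x y : ℝ) :
    |shrink m a x - shrink m a y| ≤ |x - y| := by
  wlog h : y ≤ x generalizing x y
  · rw [abs_sub_comm, abs_sub_comm x]
    exact this y x (le_of_not_ge h)
  have h2 := clip_mono a h
  have h3 := abs_clip_sub_clip_le a x y
  rw [abs_of_nonneg (by linarith), abs_of_nonneg (by linarith)] at h3
  rw [abs_of_nonneg (by linarith : 0 ≤ x - y), shrink, shrink, abs_le]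
  have h4 : 0 ≤ m * (clip a x - clip a y) := mul_nonneg h0 (by linarith)
  have h5 : m * (clip a x - clip a y) ≤ 1 * (clip a x - clip a y) :=
    mul_le_mul_of_nonneg_right h1 (by linarith)
  constructor <;> linarith

lemma abs_shrink_sub_shrink_of_abs_le (h1 : m ≤ 1) {x y : ℝ} (hx : |x| ≤ a) (hy : |y| ≤ a) :
    |shrink m a x - shrink m a y| = (1 - m) * |x - y| := by
  rw [shrink, shrink, clip_eq_self hx, clip_eq_self hy,
    show x - m * x - (y - m * y) = (1 - m) * (x - y) by ring, abs_mul,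
    abs_of_nonneg (by linarith)]

lemma abs_shrink_le (h0 : 0 ≤ m) (h1 : m ≤ 1) (ha : 0 ≤ a) (x : ℝ) : |shrink m a x| ≤ |x| := by
  simpa [shrink, clip_eq_self (a := a) (x := 0) (by simpa)] using
    abs_shrink_sub_shrink_le (a := a) h0 h1 x 0

end Shrink

/-! ### Stability and bias of the shrinkage estimator. -/

section ShrinkageEstimator

variable {n : ℕ} {r β : ℝ}

/-- The threshold below which the shrinkage is proportional. -/
noncomputable def threshold (n : ℕ) (r β : ℝ) : ℝ := 2 * r * √(excess n r β) + 2 * r / √(n : ℝ)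

lemma threshold_nonneg (hr : 0 < r) : 0 ≤ threshold n r β := by
  unfold threshold; positivity

lemma shrinkageEstimator_eq (hr : 0 < r) (z : (Fin n → Ball r) × I) :
    shrinkageEstimator n r β z =
      shrink (min (excess n r β) 1) (threshold n r β) (sampleMean z.1) :=
  shrink_eq (threshold_nonneg hr) _

lemma shrinkage_factor_mem : 0 ≤ min (excess n r β) 1 ∧ min (excess n r β) 1 ≤ 1 :=
  ⟨le_min excess_nonneg zero_le_one, min_le_right _ _⟩

lemma abs_coe_ball_le (x : Ball r) : |(x : ℝ)| ≤ r := by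
  simpa only [mem_closedBall_zero_iff, Real.norm_eq_abs] using x.2

@[fun_prop]
lemma measurable_sampleMean : Measurable (sampleMean : (Fin n → Ball r) → ℝ) := by
  unfold sampleMean; fun_prop

lemma abs_sampleMean_le (hr : 0 < r) (D : Fin n → Ball r) : |sampleMean D| ≤ r := by
  rw [sampleMean, abs_div, Nat.abs_cast]
  refine div_le_of_le_mul₀ (by positivity) hr.le ((Finset.abs_sum_le_sum_abs _ _).trans ?_)
  refine (Finset.sum_le_sum fun i _ => abs_coe_ball_le (D i)).trans ?_
  simp [mul_comm]

lemma isEstimator_shrinkageEstimator (hr : 0 < r) {Θ : Set ℝ}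
    (hΘ : Metric.closedBall (0 : ℝ) r ⊆ Θ) : IsEstimator Θ (shrinkageEstimator n r β) where
  measurable := by unfold shrinkageEstimator; fun_prop
  mem z := hΘ <| by
    rw [mem_closedBall_zero_iff, Real.norm_eq_abs, shrinkageEstimator_eq hr]
    exact (abs_shrink_le shrinkage_factor_mem.1 shrinkage_factor_mem.2 (threshold_nonneg hr)
      _).trans (abs_sampleMean_le hr _)

lemma sampleMean_removeNth (D : Fin (n + 1) → Ball r) (i : Fin (n + 1)) :
    sampleMean (i.removeNth D) = (∑ k, (D k : ℝ) - D i) / n := by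
  rw [sampleMean, Fin.sum_univ_succAbove _ i]
  simp [Fin.removeNth]

/-- Sums `r |x - y| ≤ r² - x y`, which is `(r - x) (r + y) ≥ 0` or its mirror image. The term `-S²`
is what makes samples with a large mean stable. -/
lemma sum_abs_sub_le (D : Fin (n + 1) → Ball r) :
    r * ∑ i, ∑ j, |(D i : ℝ) - D j| ≤ ((n : ℝ) + 1) ^ 2 * r ^ 2 - (∑ k, (D k : ℝ)) ^ 2 := by
  have h (x y : Ball r) : r * |(x : ℝ) - y| ≤ r ^ 2 - x * y := by
    have hx := abs_le.1 (abs_coe_ball_le x)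
    have hy := abs_le.1 (abs_coe_ball_le y)
    rcases abs_cases ((x : ℝ) - y) with h | h <;> rw [h.1] <;> nlinarith
  simp only [Finset.mul_sum]
  refine (Finset.sum_le_sum fun i _ => Finset.sum_le_sum fun j _ => h (D i) (D j)).trans ?_
  simp only [Finset.sum_sub_distrib, ← Finset.mul_sum, ← Finset.sum_mul]
  simp only [Finset.sum_const, Finset.card_univ, Fintype.card_fin, nsmul_eq_mul]
  push_cast
  exact le_of_eq (by ring)

lemma isAverageCaseStable_shrinkageEstimator (hn : 0 < n) (hr : 0 < r) (hβ : 0 < β) :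
    IsAverageCaseStable (shrinkageEstimator n r β) (ENNReal.ofReal β) := by
  rw [isAverageCaseStable_iff]
  intro D
  have hn' : (1 : ℝ) ≤ n := by exact_mod_cast hn
  set δ := excess n r β with hδ
  have hδ0 : 0 ≤ δ := excess_nonneg
  set m := min δ 1 with hm
  set a := threshold n r β with ha
  set x : Fin (n + 1) → ℝ := fun i => sampleMean (i.removeNth D) with hx
  set S := ∑ k, (D k : ℝ) with hS
  have hm0 : 0 ≤ m := shrinkage_factor_mem.1
  have hm1 : m ≤ 1 := shrinkage_factor_mem.2
  have hrβ : r ≤ n * β * (1 + δ) := le_mul_one_add_excess hn hβ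
  have hxi (i j) : |x i - x j| = |(D i : ℝ) - D j| / n := by
    simp only [hx, sampleMean_removeNth]
    rw [← sub_div, abs_div, Nat.abs_cast, abs_sub_comm]
    congr 2; ring
  have hDsum := sum_abs_sub_le D
  have hsum : ∑ i, ∑ j, |x i - x j| = (∑ i, ∑ j, |(D i : ℝ) - D j|) / n := by
    simp only [hxi, Finset.sum_div]
  suffices h : ∑ i, ∑ j, |shrink m a (x i) - shrink m a (x j)| ≤ β * ((n : ℝ) + 1) ^ 2 by
    refine le_trans (le_of_eq ?_) (ENNReal.ofReal_le_ofReal h)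
    rw [ENNReal.ofReal_sum_of_nonneg fun i _ => Finset.sum_nonneg fun j _ => abs_nonneg _]
    refine Finset.sum_congr rfl fun i _ => ?_
    rw [ENNReal.ofReal_sum_of_nonneg fun j _ => abs_nonneg _]
    refine Finset.sum_congr rfl fun j _ => ?_
    simp only [shrinkageEstimator_eq hr, Real.enorm_eq_ofReal_abs, lintegral_const, measure_univ,
      mul_one]
    rfl
  set T := ∑ i, ∑ j, |(D i : ℝ) - D j| with hT
  have hT0 : 0 ≤ T := Finset.sum_nonneg fun i _ => Finset.sum_nonneg fun j _ => abs_nonneg _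
  -- If all leave-one-out means are in the linear zone, the factor `1 - m` suffices, as `(1 - m) (1
  -- + δ) ≤ 1`. Otherwise `|S|` is large and the spread `T` itself is small.
  by_cases hall : ∀ i, |x i| ≤ a
  · have h1 : ∑ i, ∑ j, |shrink m a (x i) - shrink m a (x j)| = (1 - m) * (T / n) := by
      rw [← hsum, Finset.mul_sum]
      refine Finset.sum_congr rfl fun i _ => ?_
      rw [Finset.mul_sum]
      exact Finset.sum_congr rfl fun j _ => abs_shrink_sub_shrink_of_abs_le hm1 (hall i) (hall j)
    have h2 : T ≤ ((n : ℝ) + 1) ^ 2 * r := by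
      refine le_of_mul_le_mul_left ?_ hr
      nlinarith [sq_nonneg S]
    have h3 : (1 - m) * r ≤ n * β := by
      have h4 : (1 - m) * (1 + δ) ≤ 1 := by
        rcases min_cases δ 1 with h | h <;> rw [hm, h.1] <;> nlinarith
      have h5 : (1 - m) * r ≤ (1 - m) * (n * β * (1 + δ)) :=
        mul_le_mul_of_nonneg_left hrβ (by linarith)
      have h6 : 0 < n * β := by positivity
      nlinarith
    rw [h1, ← mul_div_assoc, div_le_iff₀ (by linarith)]
    calc (1 - m) * T ≤ (1 - m) * (((n : ℝ) + 1) ^ 2 * r) :=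
          mul_le_mul_of_nonneg_left h2 (by linarith)
      _ = ((n : ℝ) + 1) ^ 2 * ((1 - m) * r) := by ring
      _ ≤ ((n : ℝ) + 1) ^ 2 * (n * β) := by gcongr
      _ = _ := by ring
  · push Not at hall
    obtain ⟨i, hi⟩ := hall
    have h1 : ∑ i, ∑ j, |shrink m a (x i) - shrink m a (x j)| ≤ T / n := by
      rw [← hsum]
      exact Finset.sum_le_sum fun i _ => Finset.sum_le_sum fun j _ =>
        abs_shrink_sub_shrink_le hm0 hm1 _ _
    have hs : √(n : ℝ) ^ 2 = n := Real.sq_sqrt (by linarith)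
    have hs1 : 1 ≤ √(n : ℝ) := Real.one_le_sqrt.2 hn'
    have hd : √δ ^ 2 = δ := Real.sq_sqrt hδ0
    have hd0 : 0 ≤ √δ := Real.sqrt_nonneg _
    have hS1 : r * ((n + 1) * √δ) ≤ |S| := by
      have h2 : |x i| * n ≤ |S| + r := by
        simp only [hx, sampleMean_removeNth]
        rw [abs_div, Nat.abs_cast, div_mul_cancel₀ _ (by linarith)]
        exact (abs_sub _ _).trans (by linarith [abs_coe_ball_le (D i)])
      have h3 : a * n ≤ |x i| * n := by gcongr
      have h4 : a * n = r * (2 * n * √δ + 2 * √(n : ℝ)) := by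
        have : (2 * r / √(n : ℝ)) * n = 2 * r * √(n : ℝ) := by
          nth_rw 2 [← hs]; field_simp
        rw [ha, threshold, add_mul, this, ← hδ]; ring
      -- The summand `2 r / √n` of the threshold absorbs the deleted point, which changes `S` by at
      -- most `r`.
      have h5 : r * ((n + 1) * √δ + 1) ≤ r * (2 * n * √δ + 2 * √(n : ℝ)) := by
        gcongr
        · linarith
        · linarith
      linarith
    have hS2 : r ^ 2 * ((n + 1) ^ 2 * δ) ≤ S ^ 2 := by
      have : (r * ((n + 1) * √δ)) ^ 2 ≤ |S| ^ 2 := by gcongr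
      rwa [sq_abs, mul_pow, mul_pow, hd] at this
    have hS3 : S ^ 2 ≤ ((n : ℝ) + 1) ^ 2 * r ^ 2 := by nlinarith
    -- With `A = (n + 1)² r²` and `S² ≥ δ A`, the bound `r T ≤ A - S²` gives `(1 + δ) r T ≤ A`.
    have h6 : r * ((1 + δ) * T) ≤ r * (((n : ℝ) + 1) ^ 2 * r) := by
      nlinarith
    have h7 := le_of_mul_le_mul_left h6 hr
    refine h1.trans ?_
    rw [div_le_iff₀ (by linarith)]
    have h8 : (1 + δ) * T ≤ (1 + δ) * (β * ((n : ℝ) + 1) ^ 2 * n) :=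
      h7.trans <| (mul_le_mul_of_nonneg_left hrβ (by positivity)).trans (le_of_eq (by ring))
    exact le_of_mul_le_mul_left h8 (by linarith)

/-- The clipped value is at most the threshold, used when `δ ≤ 1` (then `δ ≤ 2 κ`), and at most `r`,
used when `δ ≥ 1` (then `κ ≥ 1 / 2`). -/
lemma shrinkage_bias_sq_le (hn : 0 < n) (hr : 0 < r) {x : ℝ} (hx : |x| ≤ r) :
    (min (excess n r β) 1 * clip (threshold n r β) x) ^ 2 ≤
      64 * ((excess n r β / (1 + excess n r β)) ^ 3 * r ^ 2) + 8 * (r ^ 2 / n) := by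
  have hn' : (1 : ℝ) ≤ n := by exact_mod_cast hn
  set δ := excess n r β with hδ
  have hδ0 : 0 ≤ δ := excess_nonneg
  set κ := δ / (1 + δ) with hκ
  have hκ0 : 0 ≤ κ := by positivity
  have hκδ : κ * (1 + δ) = δ := by rw [hκ]; field_simp
  have hrn : 0 ≤ r ^ 2 / n := by positivity
  rw [mul_pow, ← sq_abs (clip _ _)]
  rcases le_total δ 1 with h | h
  · rw [min_eq_left h]
    have h1 : |clip (threshold n r β) x| ^ 2 ≤ threshold n r β ^ 2 := by
      gcongr
      exact abs_clip_le (threshold_nonneg hr) x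
    have h2 : threshold n r β ^ 2 ≤ 8 * r ^ 2 * δ + 8 * (r ^ 2 / n) := by
      have h3 : (2 * r * √δ) ^ 2 = 4 * r ^ 2 * δ := by rw [mul_pow, Real.sq_sqrt hδ0]; ring
      have h4 : (2 * r / √(n : ℝ)) ^ 2 = 4 * (r ^ 2 / n) := by
        rw [div_pow, Real.sq_sqrt (by linarith)]; ring
      have := add_sq_le (a := 2 * r * √δ) (b := 2 * r / √(n : ℝ))
      rw [h3, h4] at this
      rw [threshold, ← hδ]
      linarith
    have h3 : δ ≤ 2 * κ := by nlinarith
    have h4 : δ ^ 3 ≤ (2 * κ) ^ 3 := by gcongr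
    have h5 : δ ^ 2 ≤ 1 := pow_le_one₀ hδ0 h
    calc δ ^ 2 * |clip (threshold n r β) x| ^ 2
        ≤ δ ^ 2 * (8 * r ^ 2 * δ + 8 * (r ^ 2 / n)) := by
          gcongr; exact h1.trans h2
      _ = 8 * r ^ 2 * δ ^ 3 + 8 * (δ ^ 2 * (r ^ 2 / n)) := by ring
      _ ≤ 8 * r ^ 2 * (2 * κ) ^ 3 + 8 * (1 * (r ^ 2 / n)) := by gcongr
      _ = _ := by ring
  · rw [min_eq_right h, one_pow, one_mul]
    have h1 : |clip (threshold n r β) x| ^ 2 ≤ r ^ 2 := by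
      gcongr
      exact (abs_clip_le_abs (threshold_nonneg hr) x).trans hx
    have h3 : 1 / 2 ≤ κ := by nlinarith
    have h4 : (1 / 2) ^ 3 * r ^ 2 ≤ κ ^ 3 * r ^ 2 := by gcongr
    nlinarith [sq_nonneg r]

end ShrinkageEstimator

/-! ### Risk of the shrinkage estimator. -/

section UpperBound

variable {n : ℕ} {r β : ℝ}

lemma integral_sampleMean_sub_mean_sq_le (hn : 0 < n) (P : ProbabilityMeasure (Ball r)) :
    MemLp (sampleMean (r := r) (n := n)) 2 (Measure.pi fun _ => (P : Measure (Ball r))) ∧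
    ∫ D : Fin n → Ball r, (sampleMean D - mean P) ^ 2 ∂(Measure.pi fun _ => (P : Measure (Ball r)))
      ≤ r ^ 2 / n := by
  have hn' : (0 : ℝ) < n := by exact_mod_cast hn
  let X : Ball r → ℝ := fun x => (x : ℝ) / n
  have hXb (x : Ball r) : X x ∈ Set.Icc (-(r / n)) (r / n) := by
    have := abs_le.1 (abs_coe_ball_le x)
    constructor
    · rw [← neg_div]; exact div_le_div_of_nonneg_right this.1 hn'.le
    · exact div_le_div_of_nonneg_right this.2 hn'.le
  have hX : MemLp X 2 (P : Measure (Ball r)) :=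
    MemLp.of_bound (by fun_prop) (r / n) (.of_forall fun x => abs_le.2 (hXb x))
  have hsm : (∑ i : Fin n, fun D : Fin n → Ball r => X (D i)) = sampleMean := by
    ext D; simp [sampleMean, X, Finset.sum_div]
  have hXi (i : Fin n) : MemLp (fun D : Fin n → Ball r => X (D i)) 2
      (Measure.pi fun _ => (P : Measure (Ball r))) :=
    hX.comp_measurePreserving (measurePreserving_eval _ i)
  have hL : MemLp (sampleMean (r := r) (n := n)) 2
      (Measure.pi fun _ => (P : Measure (Ball r))) := by
    rw [← hsm]; exact memLp_finsetSum' _ fun i _ => hXi i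
  refine ⟨hL, ?_⟩
  have hmean : ∫ D : Fin n → Ball r, sampleMean D ∂(Measure.pi fun _ => (P : Measure (Ball r))) =
      mean P := by
    simp only [← hsm, Finset.sum_apply]
    rw [integral_finsetSum _ fun i _ => (hXi i).integrable one_le_two]
    have h (i : Fin n) : ∫ D : Fin n → Ball r, X (D i)
        ∂(Measure.pi fun _ => (P : Measure (Ball r))) = mean P / n := by
      rw [integral_comp_eval (μ := fun _ => (P : Measure (Ball r))) (f := X) (by fun_prop),
        integral_div, mean]
    simp only [h]
    simp; field_simp
  have hv := ProbabilityTheory.variance_sum_pi (μ := fun _ : Fin n => (P : Measure (Ball r)))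
    (X := fun _ => X) fun _ => hX
  rw [hsm, ProbabilityTheory.variance_eq_integral (by fun_prop), hmean] at hv
  rw [hv]
  -- Popoviciu's inequality: a variable in `[-r / n, r / n]` has variance at most `(r / n)²`.
  have hvi := ProbabilityTheory.variance_le_sq_of_bounded (μ := (P : Measure (Ball r))) (X := X)
    (.of_forall hXb) (by fun_prop)
  simp only [Finset.sum_const, Finset.card_univ, Fintype.card_fin, nsmul_eq_mul]
  calc _ ≤ (n : ℝ) * ((r / n - -(r / n)) / 2) ^ 2 := by gcongr
    _ = r ^ 2 / n := by field_simp; ring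

lemma maxRisk_shrinkageEstimator_le (hn : 0 < n) (hr : 0 < r) :
    maxRisk (boundedClass r) mean (shrinkageEstimator n r β) ≤
      ENNReal.ofReal (146 * rate n r β) := by
  refine iSup₂_le fun P _ => ?_
  obtain ⟨hL, hv⟩ := integral_sampleMean_sub_mean_sq_le hn P
  set K := 64 * ((excess n r β / (1 + excess n r β)) ^ 3 * r ^ 2) + 8 * (r ^ 2 / n) with hK
  let Q : Measure (Fin n → Ball r) := Measure.pi fun _ => (P : Measure (Ball r))
  have hi : Integrable (fun D : Fin n → Ball r => (sampleMean D - mean P) ^ 2) Q :=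
    (hL.sub (memLp_const _)).integrable_sq
  -- The shrinkage correction is bounded by `K` for every sample, so `(x - u)² ≤ 2 x² + 2 u²`
  -- suffices. The constant is `146 = 2 + 2 (64 + 8)`.
  have hpt (z : (Fin n → Ball r) × I) : ‖shrinkageEstimator n r β z - mean P‖ₑ ^ 2 ≤
      ENNReal.ofReal (2 * (sampleMean z.1 - mean P) ^ 2 + 2 * K) := by
    rw [Real.enorm_eq_ofReal_abs, ← ENNReal.ofReal_pow (abs_nonneg _), sq_abs,
      shrinkageEstimator_eq hr]
    refine ENNReal.ofReal_le_ofReal ?_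
    have h1 := shrinkage_bias_sq_le (β := β) hn hr (abs_sampleMean_le hr z.1)
    rw [← hK] at h1
    set u := min (excess n r β) 1 * clip (threshold n r β) (sampleMean z.1) with hu
    rw [shrink, ← hu]
    nlinarith [sq_nonneg (sampleMean z.1 - mean P + u)]
  calc risk mean (shrinkageEstimator n r β) P
      ≤ ∫⁻ z, ENNReal.ofReal (2 * (sampleMean z.1 - mean P) ^ 2 + 2 * K)
          ∂(Q.prod (volume : Measure I)) := lintegral_mono hpt
    _ = ∫⁻ D, ENNReal.ofReal (2 * (sampleMean D - mean P) ^ 2 + 2 * K) ∂Q :=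
        measurePreserving_fst.lintegral_comp
          (f := fun D => ENNReal.ofReal (2 * (sampleMean D - mean P) ^ 2 + 2 * K)) (by fun_prop)
    _ = ENNReal.ofReal (∫ D, (2 * (sampleMean D - mean P) ^ 2 + 2 * K) ∂Q) := by
        refine (ofReal_integral_eq_lintegral_ofReal ((hi.const_mul 2).add (integrable_const _))
          (.of_forall fun D => ?_)).symm
        have hK0 : 0 ≤ K := (sq_nonneg _).trans
          (shrinkage_bias_sq_le (β := β) (x := 0) hn hr (by simpa using hr.le))
        exact add_nonneg (mul_nonneg zero_le_two (sq_nonneg _)) (mul_nonneg zero_le_two hK0)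
    _ ≤ ENNReal.ofReal (146 * rate n r β) := by
        refine ENNReal.ofReal_le_ofReal ?_
        rw [integral_add (hi.const_mul 2) (integrable_const _), integral_const_mul]
        have h1 : (excess n r β / (1 + excess n r β)) ^ 3 * r ^ 2 ≤ rate n r β := le_max_left _ _
        have h2 : r ^ 2 / n ≤ rate n r β := le_max_right _ _
        simp only [integral_const, probReal_univ, one_smul]
        linarith

end UpperBound

end StableMean

theorem theorem6 :
    ∃ (N : ℕ) (c C : ℝ), 0 < c ∧ c < C ∧
      ∀ (n : ℕ), N ≤ n → ∀ (r β : ℝ), 0 < r → 0 < β →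
        ∀ (Θ : Set ℝ), Metric.closedBall (0 : ℝ) r ⊆ Θ →
          -- the minimax risk is of the order of the rate, up to universal constants
          (ENNReal.ofReal (c * StableMean.rate n r β) ≤
              StableMean.stableMinimaxRisk (StableMean.boundedClass r) StableMean.mean Θ n
                (ENNReal.ofReal β) ∧
            StableMean.stableMinimaxRisk (StableMean.boundedClass r) StableMean.mean Θ n
                (ENNReal.ofReal β) ≤ ENNReal.ofReal (C * StableMean.rate n r β)) ∧
          -- the shrinkage estimator is admissible and rate optimal
          StableMean.IsEstimator Θ (StableMean.shrinkageEstimator n r β) ∧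
          StableMean.IsAverageCaseStable (StableMean.shrinkageEstimator n r β)
            (ENNReal.ofReal β) ∧
          StableMean.maxRisk (StableMean.boundedClass r) StableMean.mean
              (StableMean.shrinkageEstimator n r β) ≤
            ENNReal.ofReal C *
              StableMean.stableMinimaxRisk (StableMean.boundedClass r) StableMean.mean Θ n
                (ENNReal.ofReal β) := by
  -- `2336 = 16 * 146` is the ratio of the upper and lower constants, as the optimality claim
  -- requires.
  refine ⟨8, 1 / 16, 2336, by norm_num, by norm_num, fun n hn r β hr hβ Θ hΘ => ?_⟩
  have hlow := StableMean.le_stableMinimaxRisk hn hr hβ Θ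
  have hest := StableMean.isEstimator_shrinkageEstimator (n := n) (β := β) hr hΘ
  have hstab := StableMean.isAverageCaseStable_shrinkageEstimator (n := n) (by lia) hr hβ
  have hup := StableMean.maxRisk_shrinkageEstimator_le (n := n) (β := β) (by lia) hr
  refine ⟨⟨hlow, ?_⟩, hest, hstab, ?_⟩
  · refine le_trans ?_ (hup.trans (ENNReal.ofReal_le_ofReal ?_))
    · exact iInf_le_of_le _ (iInf₂_le hest hstab)
    · have := StableMean.rate_nonneg (n := n) (r := r) (β := β)
      linarith
  · calc _ ≤ ENNReal.ofReal (146 * StableMean.rate n r β) := hup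
      _ = ENNReal.ofReal 2336 * ENNReal.ofReal (1 / 16 * StableMean.rate n r β) := by
        rw [← ENNReal.ofReal_mul (by norm_num)]; congr 1; ring
      _ ≤ _ := by gcongr
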